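/- **Conventions.** Let $R$ be a commutative ring. A *semisimple rigid tensor category over $R$* is an $R$-linear additive rigid monoidal category with bilinear tensor product, having objects $S_i$ $(i\in I)$ with $\mathrm{End}(S_i)=R$ and $\mathrm{Hom}(S_i,S_j)=0$ for $i\ne j$, such that the unit object is isomorphic to one of the $S_i$ and every object is a finite direct sum of the $S_i$. Over an algebraically closed field $k$ this is the same as a $k$-linear abelian rigid monoidal category with bilinear tensor product and finite-dimensional $\mathrm{Hom}$-spaces, in which the unit object is simple and every object is a finite direct sum of simple objects. A *fusion category* is such a category (over $k$) with finitely many isomorphism classes of simple objects. If $V$ is simple and $W$ is an object which is both a left and a right dual of $V$, with duality morphisms $\eta:\mathbf 1\to V\otimes W$, $\varepsilon: W\otimes V\to\mathbf 1$ and $\eta':\mathbf 1\to W\otimes V$, $\varepsilon':V\otimes W\to \mathbf 1$, then *Müger's squared norm* of $V$ is $|V|^2=(\varepsilon'\circ\eta)(\varepsilon\circ\eta')\in \mathrm{End}(\mathbf 1)=k$. For a fusion category, $\mathrm{FPdim}(V)$ is the largest real eigenvalue of the matrix of multiplication by $[V]$ on the Grothendieck ring, in the basis of the classes of the simple objects.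 Let $p$ be a prime, $\overline{\mathbb Z}_p\subset\overline{\mathbb Q}_p$ the ring of integers, $\mathfrak m$ its maximal ideal, $\overline{\mathbb F}_p=\overline{\mathbb Z}_p/\mathfrak m$, and let $\mathcal C$ be a semisimple rigid tensor category over $\overline{\mathbb Q}$. For an embedding $\iota:\overline{\mathbb Q}\to\overline{\mathbb Q}_p$ we say that $\mathcal C$ has *good reduction at $\iota$* if there are a semisimple rigid tensor category $\mathcal C_p$ over $\overline{\mathbb F}_p$ with the same Grothendieck ring as $\mathcal C$, and a semisimple rigid tensor category $\widetilde{\mathcal C}_p$ over $\overline{\mathbb Z}_p$, with tensor equivalences $\widetilde{\mathcal C}_p\otimes_{\overline{\mathbb Z}_p}\overline{\mathbb F}_p\cong\mathcal C_p$ and $\widetilde{\mathcal C}_p\otimes_{\overline{\mathbb Z}_p}\overline{\mathbb Q}_p\cong\mathcal C\otimes_{\overline{\mathbb Q},\iota}\overline{\mathbb Q}_p$. The prime $p$ is *good* for $\mathcal C$ if $\mathcal C$ has good reduction at every $\iota$. An algebraic number $\alpha$ is *relatively prime* to $p$ if $p$ divides neither the numerator nor the denominator of the norm $N_{\mathbb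 Q(\alpha)/\mathbb Q}(\alpha)\in\mathbb Q$; if $\alpha$ is an algebraic integer, this means that the integer $N_{\mathbb Q(\alpha)/\mathbb Q}(\alpha)$ is prime to $p$. **Proposition.** Let $\mathcal C$ be a semisimple rigid tensor category over $\overline{\mathbb Q}$ and $p$ a prime. Then $|V|^2$ exists and is well defined for every simple object $V$ of $\mathcal C$, and: 1. if $\mathcal C$ has good reduction at an embedding $\iota$, then $\iota(|V|^2)$ is a unit of $\overline{\mathbb Z}_p$ for every simple object $V$; 2. if $p$ is a good prime for $\mathcal C$, then $p$ is relatively prime to $|V|^2$ for every simple object $V$. **Corollary.** Suppose moreover that $\mathcal C$ is a fusion category which is pseudounitary with respect to some embedding $\tau:\overline{\mathbb Q}\to\mathbb C$, i.e. $\tau(|V|^2)=\mathrm{FPdim}(V)^2$ for every simple object $V$. 1. If $\mathcal C$ has good reduction at $\iota$, then for every simple object $V$ there is $d\in\overline{\mathbb Q}$ with $\tau(d)=\mathrm{FPdim}(V)$ such that $\iota(d)$ is a unit of $\overline{\mathbb Z}_p$. 2. If $p$ is a good prime for $\mathcal C$, then for every simple object $V$ the number $\mathrm{FPdim}(V)$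 is an algebraic integer relatively prime to $p$. -/

import Mathlib

open CategoryTheory MonoidalCategory Limits

universe u v

noncomputable section

namespace TensorReduction

/-! ### Semisimple rigid tensor categories -/

/-- A `k`-linear abelian rigid monoidal category (with bilinear tensor product) over a field `k`
is a *semisimple rigid tensor category* if its spaces of morphisms are finite dimensional, the unit
object is simple, and every object is a finite direct sum of simple objects. -/
structure IsSemisimpleTensorCategory (k : Type) [Field k] (C : Type u) [Category.{v} C]
    [Abelian C] [Linear k C] [MonoidalCategory C] [MonoidalPreadditive C] [MonoidalLinear k C]
    [RigidCategory C] : Prop where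
  finite_hom : ∀ X Y : C, Module.Finite k (X ⟶ Y)
  simple_unit : Simple (𝟙_ C)
  semisimple :
    haveI : HasFiniteBiproducts C := Abelian.hasFiniteBiproducts
    ∀ X : C, ∃ (n : ℕ) (S : Fin n → C),
      (∀ i, Simple (S i)) ∧ Nonempty (X ≅ ⨁ S)

/-- An `R`-linear additive rigid monoidal category (with bilinear tensor product) over a
commutative ring `R` is a *semisimple rigid tensor category over `R`* if there are objects `S i`
such that `Hom(S i, S j) = 0` for `i ≠ j`, `End(S i) = R`, the unit object is one of the `S i` (up
to isomorphism), and every object is a finite direct sum of objects `S i`. In particular all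
modules of morphisms are free of finite rank. -/
structure IsSemisimpleTensorCategoryOver (R : Type) [CommRing R] (C : Type u) [Category.{v} C]
    [Preadditive C] [HasFiniteBiproducts C] [Linear R C] [MonoidalCategory C]
    [MonoidalPreadditive C] [MonoidalLinear R C] [RigidCategory C] : Prop where
  exists_simples : ∃ (I : Type u) (S : I → C),
    (∀ i, Function.Bijective fun r : R ↦ r • 𝟙 (S i)) ∧
    (∀ i j, i ≠ j → ∀ f : S i ⟶ S j, f = 0) ∧
    (∃ i, Nonempty (𝟙_ C ≅ S i)) ∧
    ∀ X : C, ∃ (n : ℕ) (c : Fin n → I), Nonempty (X ≅ ⨁ fun a ↦ S (c a))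

/-! ### Extension of scalars -/

/-- Let `φ : R →+* S` be a homomorphism of commutative rings, `C` an `R`-linear and `D` an
`S`-linear monoidal category. A `ScalarExtension φ C D` is a monoidal functor `F : C ⥤ D` which
exhibits `D` as (a category tensor equivalent to) the extension of scalars `C ⊗_R S`, i.e. the
category with the objects of `C` and the modules of morphisms `S ⊗_R Hom_C(X, Y)`:
`F` is additive, compatible with scalars along `φ`, essentially surjective, and the map
`S ⊗_R Hom_C(X, Y) → Hom_D(F X, F Y)` that it induces is bijective for all `X`, `Y`. -/
structure ScalarExtension {R S : Type} [CommRing R] [CommRing S] (φ : R →+* S)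
    (C : Type u) [Category.{v} C] [Preadditive C] [Linear R C] [MonoidalCategory C]
    (D : Type u) [Category.{v} D] [Preadditive D] [Linear S D] [MonoidalCategory D] where
  functor : C ⥤ D
  monoidal : functor.Monoidal
  additive : functor.Additive
  map_smul : ∀ {X Y : C} (r : R) (f : X ⟶ Y), functor.map (r • f) = φ r • functor.map f
  essSurj : functor.EssSurj
  isBaseChange : ∀ X Y : C,
    letI : Algebra R S := φ.toAlgebra
    letI : Module R (functor.obj X ⟶ functor.obj Y) := Module.compHom _ φ
    haveI : IsScalarTower R S (functor.obj X ⟶ functor.obj Y) :=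
      ⟨fun r s f ↦ mul_smul (φ r) s f⟩
    IsBaseChange S
      ({ toFun := fun f ↦ functor.map f
         map_add' := fun _ _ ↦ functor.map_add
         map_smul' := map_smul } :
        (X ⟶ Y) →ₗ[R] (functor.obj X ⟶ functor.obj Y))

/-! ### Simple objects, Grothendieck rings -/

section Grothendieck

variable (k : Type) [Field k] (C : Type u) [Category.{v} C]

/-- The set of isomorphism classes of simple objects of `C`. -/
def SimpleClass [HasZeroMorphisms C] : Type u :=
  Quotient ((isIsomorphicSetoid C).comap (Subtype.val : {X : C // Simple X} → C))

variable {C}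

/-- A simple object in a given isomorphism class. -/
def SimpleClass.rep [HasZeroMorphisms C] (a : SimpleClass C) : C :=
  (Quotient.out a : {X : C // Simple X}).1

/-- The multiplicity of (the class) `c` in `V ⊗ b`, for a semisimple tensor category over an
algebraically closed field `k`. These are the matrix entries of multiplication by `[V]` in the
Grothendieck ring of `C`, in the basis of the classes of simple objects. -/
def multiplicity [Preadditive C] [Linear k C] [MonoidalCategory C] (V : C)
    (c b : SimpleClass C) : ℕ :=
  Module.finrank k (c.rep ⟶ V ⊗ b.rep)

/-- The categories `C` over `k` and `C'` over `k'` have the same Grothendieck ring, as a based ring: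
there is a bijection between their simple objects that preserves the structure constants. -/
def SameGrothendieckRing (k : Type) [Field k] (C : Type u) [Category.{v} C] [Preadditive C]
    [Linear k C] [MonoidalCategory C] (k' : Type) [Field k'] (C' : Type u) [Category.{v} C']
    [Preadditive C'] [Linear k' C'] [MonoidalCategory C'] : Prop :=
  ∃ e : SimpleClass C ≃ SimpleClass C', ∀ a b c : SimpleClass C,
    multiplicity k a.rep c b = multiplicity k' (e a).rep (e c) (e b)

/-- `FPdim(V)`: the largest real eigenvalue of the matrix of multiplication by `[V]` in the
Grothendieck ring of a fusion category (a semisimple rigid tensor category with finitely many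
simple objects). -/
def fpDim [Preadditive C] [Linear k C] [MonoidalCategory C] [Finite (SimpleClass C)]
    (V : C) : ℝ :=
  letI : Fintype (SimpleClass C) := Fintype.ofFinite _
  sSup {t : ℝ | ∃ x : SimpleClass C → ℝ, x ≠ 0 ∧
    (Matrix.of fun c b ↦ (multiplicity k V c b : ℝ)).mulVec x = t • x}

/-! ### Müger's squared norm -/

/-- `c` is Müger's squared norm `|V|²` of the simple object `V`. Choose an object `W` that is both
a left and a right dual of `V`, with duality morphisms
`η : 𝟙 ⟶ V ⊗ W`, `ε : W ⊗ V ⟶ 𝟙` and `η' : 𝟙 ⟶ W ⊗ V`, `ε' : V ⊗ W ⟶ 𝟙`; then `|V|²` is the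
product of the scalars `ε' ∘ η` and `ε ∘ η'` in `End(𝟙) = k`. -/
def IsMugerSquaredNorm [Preadditive C] [Linear k C] [MonoidalCategory C] (V : C) (c : k) : Prop :=
  ∃ (W : C) (P : ExactPairing V W) (Q : ExactPairing W V),
    (P.coevaluation' ≫ Q.evaluation') ≫ (Q.coevaluation' ≫ P.evaluation') = c • 𝟙 (𝟙_ C)

/-- The fusion category `C` over `k` is pseudounitary (with respect to an embedding `τ` of `k` in
the complex numbers): `|V|² = FPdim(V)²` for every simple object `V`. -/
def IsPseudounitary [Preadditive C] [Linear k C] [MonoidalCategory C]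
    [Finite (SimpleClass C)] (τ : k →+* ℂ) : Prop :=
  ∀ V : C, Simple V → ∀ c : k, IsMugerSquaredNorm k V c → τ c = ((fpDim k V : ℝ) : ℂ) ^ 2

end Grothendieck

/-! ### Good reduction -/

section Good

variable (p : ℕ) [Fact p.Prime]

/-- The ring of integers of the algebraic closure of `ℚ_p`: the elements of norm at most `1`. -/
abbrev ZpBar : Type := (Valued.v : Valuation (PadicAlgCl p) NNReal).valuationSubring

/-- The quotient of `ZpBar p` by its maximal ideal (an algebraic closure of the field with `p`
elements). -/
abbrev FpBar : Type := IsLocalRing.ResidueField (ZpBar p)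

/-- A good reduction modulo `p` of a tensor category `C` over the field of algebraic numbers, with
respect to an embedding `ι` of this field in the algebraic closure of `ℚ_p`. -/
structure GoodReduction (ι : AlgebraicClosure ℚ →+* PadicAlgCl p)
    (C : Type u) [Category.{v} C] [Preadditive C] [Linear (AlgebraicClosure ℚ) C]
    [MonoidalCategory C] where
  /-- The reduction, a semisimple rigid tensor category over `FpBar p`. -/
  Red : Type u
  [redCategory : Category.{v} Red]
  [redAbelian : Abelian Red]
  [redLinear : Linear (FpBar p) Red]
  [redMonoidal : MonoidalCategory Red]
  [redMonoidalPreadditive : MonoidalPreadditive Red]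
  [redMonoidalLinear : MonoidalLinear (FpBar p) Red]
  [redRigid : RigidCategory Red]
  red_semisimple : IsSemisimpleTensorCategory (FpBar p) Red
  /-- The reduction categorifies the Grothendieck ring of `C`. -/
  red_grothendieck : SameGrothendieckRing (AlgebraicClosure ℚ) C (FpBar p) Red
  /-- The lift, a semisimple rigid tensor category over `ZpBar p`. -/
  Lift : Type u
  [liftCategory : Category.{v} Lift]
  [liftPreadditive : Preadditive Lift]
  [liftBiproducts : HasFiniteBiproducts Lift]
  [liftLinear : Linear (ZpBar p) Lift]
  [liftMonoidal : MonoidalCategory Lift]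
  [liftMonoidalPreadditive : MonoidalPreadditive Lift]
  [liftMonoidalLinear : MonoidalLinear (ZpBar p) Lift]
  [liftRigid : RigidCategory Lift]
  lift_semisimple : IsSemisimpleTensorCategoryOver (ZpBar p) Lift
  /-- The lift yields `Red` upon reduction by the maximal ideal. -/
  reduction : ScalarExtension (IsLocalRing.residue (ZpBar p)) Lift Red
  /-- The common scalar extension of the lift and of `C` to the algebraic closure of `ℚ_p`, which
  expresses that these two scalar extensions are tensor equivalent. -/
  Gen : Type u
  [genCategory : Category.{v} Gen]
  [genPreadditive : Preadditive Gen]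
  [genLinear : Linear (PadicAlgCl p) Gen]
  [genMonoidal : MonoidalCategory Gen]
  [genMonoidalPreadditive : MonoidalPreadditive Gen]
  [genMonoidalLinear : MonoidalLinear (PadicAlgCl p) Gen]
  liftExtension : ScalarExtension (algebraMap (ZpBar p) (PadicAlgCl p)) Lift Gen
  extension : ScalarExtension ι C Gen

variable (C : Type u) [Category.{v} C] [Preadditive C] [Linear (AlgebraicClosure ℚ) C]
  [MonoidalCategory C]

/-- The prime `p` is good for `C` at the place of the field of algebraic numbers above `p` that is
given by `ι`. -/
def IsGoodPrimeAt (ι : AlgebraicClosure ℚ →+* PadicAlgCl p) : Prop :=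
  Nonempty (GoodReduction p ι C)

/-- The prime `p` is good for `C`, for every embedding of the field of algebraic numbers in the
algebraic closure of `ℚ_p`. -/
def IsGoodPrime : Prop :=
  ∀ ι : AlgebraicClosure ℚ →+* PadicAlgCl p, IsGoodPrimeAt p C ι

end Good

/-! ### Coprimality with a prime number -/

/-- The norm of an algebraic number `α`, from `ℚ(α)` to `ℚ`. It is an integer if `α` is an algebraic
integer. -/
def algebraicNorm {K : Type} [Field K] [Algebra ℚ K] (α : K) : ℚ :=
  Algebra.norm ℚ (IntermediateField.AdjoinSimple.gen ℚ α)

/-- The prime `p` and the algebraic number `α` are relatively prime: `p` divides neither the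
numerator nor the denominator of the norm of `α`. If `α` is an algebraic integer, the norm is an
integer, and the condition says that `p` does not divide it. -/
def IsRelativelyPrime (p : ℕ) {K : Type} [Field K] [Algebra ℚ K] (α : K) : Prop :=
  IsAlgebraic ℚ α ∧ IsCoprime (algebraicNorm α).num (p : ℤ) ∧
    Nat.Coprime (algebraicNorm α).den p

end TensorReduction

end

/-! Over a field, the squared norm of a simple object `V` with scalar endomorphisms is nonzero. The
coevaluation `𝟙 ⟶ V ⊗ W` is a nonzero map out of the simple unit, so it splits; the retraction
corresponds to a nonzero map from `V` to the dual of `W`, which is then an isomorphism. Thus `W` is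
a two-sided dual, with one of the two scalars equal to `1`. The same argument applied to `W` shows
that the other scalar is nonzero (`mugerEnd_ne_zero`). The product does not depend on the choices,
because a change of pairing multiplies its two factors by inverse scalars (`mugerEnd_unique`).

Let `X` be an object of the lift with `End X = R`. Its reduction is simple, hence isomorphic to its
double dual; over a local ring this isomorphism lifts, so `X` has a two-sided dual and a squared
norm `r` in `R`. The reduction of `r` is a squared norm of a simple object, hence nonzero, so `r` is
a unit (`exists_isUnit_mugerEnd`). In the common generic extension, the image of a simple `V` is
isomorphic to the image of such an `X`, and uniqueness gives `ι c = r`.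

If this holds for every `ι`, all conjugates of `c` have `p`-adic absolute value `1`, and so does
their product, the norm. In the pseudounitary case a square root of `c` maps to `FPdim V`, and its
absolute value is `1` as well. -/

noncomputable section

namespace TensorReduction

open Functor.LaxMonoidal Functor.OplaxMonoidal

/-! ### Exact pairings -/

section Pairing

variable {C : Type u} [Category.{v} C] [MonoidalCategory C] {V V' W W' : C}

/-- The endomorphism of the unit object attached to duality morphisms that exhibit `W` as both a
left and a right dual of `V`. -/
def mugerEnd (P : ExactPairing V W) (Q : ExactPairing W V) : 𝟙_ C ⟶ 𝟙_ C :=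
  (P.coevaluation' ≫ Q.evaluation') ≫ (Q.coevaluation' ≫ P.evaluation')

theorem exists_iso_of_exactPairing (P : ExactPairing V W) (P' : ExactPairing V W') :
    ∃ e : W ≅ W', P.coevaluation' ≫ V ◁ e.hom = P'.coevaluation' ∧
      e.hom ▷ V ≫ P'.evaluation' = P.evaluation' := by
  refine ⟨rightDualIso P P', ?_, ?_⟩
  · have := @coevaluation_comp_rightAdjointMate C _ _ V V ⟨W'⟩ ⟨W⟩ (𝟙 V)
    rw [id_whiskerRight, Category.comp_id] at this
    exact this
  · have := @rightAdjointMate_comp_evaluation C _ _ V V ⟨W'⟩ ⟨W⟩ (𝟙 V)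
    rw [MonoidalCategory.whiskerLeft_id, Category.id_comp] at this
    exact this

theorem coevaluation_comp_whiskerLeft_injective (P : ExactPairing V W) {f g : W ⟶ W'}
    (h : P.coevaluation' ≫ V ◁ f = P.coevaluation' ≫ V ◁ g) : f = g := by
  have h1 := congrArg (tensorLeftHomEquiv _ V W _).symm h
  have key (f : W ⟶ W') := tensorLeftHomEquiv_symm_coevaluation_comp_whiskerLeft (Y := V) f
  unfold ExactPairing.coevaluation at key
  rw [key, key] at h1
  simpa using h1

/-- Surjectivity half of the adjunction bijection between `V ⟶ V'` and `𝟙 ⟶ V' ⊗ W`. -/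
theorem exists_coevaluation_comp_whiskerRight (P : ExactPairing V W) (h : 𝟙_ C ⟶ V' ⊗ W) :
    ∃ g : V ⟶ V', P.coevaluation' ≫ g ▷ W = h := by
  refine ⟨(λ_ _).inv ≫ (tensorRightHomEquiv _ V W _).symm h, ?_⟩
  apply (tensorRightHomEquiv _ V W _).symm.injective
  have key := tensorRightHomEquiv_symm_coevaluation_comp_whiskerRight (Y := V) (Y' := W)
    ((λ_ _).inv ≫ (tensorRightHomEquiv _ V W _).symm h)
  unfold ExactPairing.coevaluation at key
  rw [key]
  simp

theorem exists_whiskerRight_comp_evaluation (P : ExactPairing V W) (h : W' ⊗ V ⟶ 𝟙_ C) :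
    ∃ g : W' ⟶ W, g ▷ V ≫ P.evaluation' = h := by
  refine ⟨tensorRightHomEquiv _ V W _ h ≫ (λ_ _).hom, ?_⟩
  apply (tensorRightHomEquiv _ V W _).injective
  have key := @tensorRightHomEquiv_whiskerRight_comp_evaluation C _ _ V W' ⟨W⟩
    (tensorRightHomEquiv _ V W _ h ≫ (λ_ _).hom)
  refine key.trans ?_
  simp

theorem mugerEnd_congr_right (P : ExactPairing V W) (P' : ExactPairing V W')
    (Q' : ExactPairing W' V) : ∃ Q : ExactPairing W V, mugerEnd P Q = mugerEnd P' Q' := by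
  obtain ⟨e, h1, h2⟩ := exists_iso_of_exactPairing P P'
  refine ⟨exactPairingCongrLeft e, ?_⟩
  change (P.coevaluation' ≫ V ◁ e.hom ≫ Q'.evaluation') ≫
    (Q'.coevaluation' ≫ e.inv ▷ V) ≫ P.evaluation' = _
  simp [mugerEnd, ← h1, ← h2]

theorem exists_mugerEnd_of_iso (i : V ≅ V') (P : ExactPairing V' W) (Q : ExactPairing W V') :
    ∃ (P' : ExactPairing V W) (Q' : ExactPairing W V), mugerEnd P' Q' = mugerEnd P Q := by
  refine ⟨exactPairingCongrLeft i, exactPairingCongrRight i, ?_⟩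
  change ((P.coevaluation' ≫ i.inv ▷ W) ≫ i.hom ▷ W ≫ Q.evaluation') ≫
    (Q.coevaluation' ≫ W ◁ i.inv) ≫ W ◁ i.hom ≫ P.evaluation' = _
  simp [mugerEnd]

variable {D : Type*} [Category* D] [MonoidalCategory D] (F : C ⥤ D) [F.Monoidal]

/-- The image of an exact pairing under a monoidal functor. -/
@[reducible]
def mapExactPairing (P : ExactPairing V W) : ExactPairing (F.obj V) (F.obj W) where
  coevaluation' := ε F ≫ F.map P.coevaluation' ≫ δ F V W
  evaluation' := μ F W V ≫ F.map P.evaluation' ≫ η F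
  coevaluation_evaluation' := by
    have h := congrArg (fun f ↦ F.obj W ◁ ε F ≫ μ F _ _ ≫ F.map f ≫ δ F _ _ ≫ η F ▷ F.obj W)
      P.coevaluation_evaluation'
    simp only [Functor.map_comp, Functor.Monoidal.map_whiskerLeft,
      Functor.Monoidal.map_whiskerRight, Functor.Monoidal.map_associator_inv,
      Functor.Monoidal.map_rightUnitor, Functor.Monoidal.map_leftUnitor_inv, Category.assoc,
      Functor.Monoidal.μ_δ_assoc, Functor.Monoidal.whiskerLeft_ε_η_assoc] at h
    simpa using h
  evaluation_coevaluation' := by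
    have h := congrArg (fun f ↦ ε F ▷ F.obj V ≫ μ F _ _ ≫ F.map f ≫ δ F _ _ ≫ F.obj V ◁ η F)
      P.evaluation_coevaluation'
    simp only [Functor.map_comp, Functor.Monoidal.map_whiskerLeft,
      Functor.Monoidal.map_whiskerRight, Functor.Monoidal.map_associator,
      Functor.Monoidal.map_rightUnitor_inv, Functor.Monoidal.map_leftUnitor, Category.assoc,
      Functor.Monoidal.μ_δ_assoc, Functor.Monoidal.whiskerRight_ε_η_assoc] at h
    simpa using h

theorem mugerEnd_mapExactPairing (P : ExactPairing V W) (Q : ExactPairing W V) :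
    mugerEnd (mapExactPairing F P) (mapExactPairing F Q) = ε F ≫ F.map (mugerEnd P Q) ≫ η F := by
  change ((ε F ≫ F.map P.coevaluation' ≫ δ F V W) ≫ μ F V W ≫ F.map Q.evaluation' ≫ η F) ≫
    (ε F ≫ F.map Q.coevaluation' ≫ δ F W V) ≫ μ F W V ≫ F.map P.evaluation' ≫ η F = _
  simp [mugerEnd]

end Pairing

/-! ### Objects with scalar endomorphisms -/

section ScalarEnd

variable {R : Type} [CommRing R] {C : Type u} [Category.{v} C] [Preadditive C] [Linear R C]

variable (R) in
/-- All endomorphisms of `X` are multiples of the identity. -/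
def ScalarEnd (X : C) : Prop :=
  ∀ f : X ⟶ X, ∃ r : R, f = r • 𝟙 X

theorem ScalarEnd.of_iso {X Y : C} (h : ScalarEnd R X) (i : X ≅ Y) : ScalarEnd R Y := by
  intro f
  obtain ⟨r, hr⟩ := h (i.hom ≫ f ≫ i.inv)
  refine ⟨r, ?_⟩
  have := congrArg (fun g ↦ i.inv ≫ g ≫ i.hom) hr
  simpa using this

theorem smul_id_faithful_of_iso {X Y : C} (i : X ≅ Y) {a b : R} (h : a • 𝟙 X = b • 𝟙 X) :
    a • 𝟙 Y = b • 𝟙 Y := by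
  have := congrArg (fun g ↦ i.inv ≫ g ≫ i.hom) h
  simpa using this

variable [MonoidalCategory C] [MonoidalPreadditive C] [MonoidalLinear R C] {V V' W W' : C}

/-- Endomorphisms of `V` and of `W` both correspond to maps `𝟙 ⟶ V ⊗ W`, and multiples of the
identity correspond to multiples of the coevaluation on either side. -/
theorem ScalarEnd.of_exactPairing (h : ScalarEnd R V) (P : ExactPairing V W) : ScalarEnd R W := by
  intro f
  obtain ⟨g, hg⟩ := exists_coevaluation_comp_whiskerRight P (P.coevaluation' ≫ V ◁ f)
  obtain ⟨r, rfl⟩ := h g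
  refine ⟨r, coevaluation_comp_whiskerLeft_injective P ?_⟩
  rw [← hg]
  simp

theorem mugerEnd_unique (h : ScalarEnd R V) (P : ExactPairing V W) (Q : ExactPairing W V)
    (P' : ExactPairing V W') (Q' : ExactPairing W' V) : mugerEnd P Q = mugerEnd P' Q' := by
  obtain ⟨Q₁, h₁⟩ := mugerEnd_congr_right P P' Q'
  rw [← h₁]
  -- With `W` now fixed, `Q` and `Q₁` differ by an automorphism `r` of `V`: `Q₁` has `r` times the
  -- coevaluation of `Q`, while `Q` has `r` times the evaluation of `Q₁`. The factor cancels in the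
  -- product.
  obtain ⟨e, h1, h2⟩ := exists_iso_of_exactPairing Q Q₁
  obtain ⟨r, hr⟩ := h e.hom
  rw [hr] at h1 h2
  simp only [mugerEnd]
  rw [← h1, ← h2]
  simp

end ScalarEnd

/-- The idempotent `b ≫ a` is a scalar that fixes the nonzero map `a`, so it is `1`: a nonzero
retract of such an object is the whole object. -/
theorem ScalarEnd.comp_eq_id_of_retract {k : Type} [Field k] {C : Type u} [Category.{v} C]
    [Preadditive C] [Linear k C] {X Y : C} (h : ScalarEnd k X) {a : Y ⟶ X} {b : X ⟶ Y}
    (hab : a ≫ b = 𝟙 Y) (h0 : 𝟙 Y ≠ 0) : b ≫ a = 𝟙 X := by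
  obtain ⟨r, hr⟩ := h (b ≫ a)
  have ha : r • a = a := by
    have : a ≫ b ≫ a = a := by rw [reassoc_of% hab]
    rwa [hr, Linear.comp_smul, Category.comp_id] at this
  have ha0 : a ≠ 0 := fun ha ↦ h0 (by rw [← hab, ha, zero_comp])
  have h1 : (r - 1) • a = 0 := by rw [sub_smul, ha, one_smul, sub_self]
  rw [hr, sub_eq_zero.mp ((smul_eq_zero.mp h1).resolve_right ha0), one_smul]

/-! ### Simple objects of semisimple tensor categories -/

namespace IsSemisimpleTensorCategory

variable {k : Type} [Field k] {C : Type u} [Category.{v} C] [Abelian C] [Linear k C]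
  [MonoidalCategory C] [MonoidalPreadditive C] [MonoidalLinear k C] [RigidCategory C]
  {V W : C}

/-- Some component of `f` into a simple summand of `X` is nonzero, hence invertible by Schur's
lemma. -/
theorem exists_retraction (hC : IsSemisimpleTensorCategory k C)
    {V X : C} [Simple V] {f : V ⟶ X} (hf : f ≠ 0) : ∃ r : X ⟶ V, f ≫ r = 𝟙 V := by
  have : HasFiniteBiproducts C := Abelian.hasFiniteBiproducts
  obtain ⟨n, S, hS, ⟨e⟩⟩ := hC.semisimple X
  have : ∃ i, (f ≫ e.hom) ≫ biproduct.π S i ≠ 0 := by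
    by_contra! h
    have h0 : f ≫ e.hom = 0 := biproduct.hom_ext _ _ fun i ↦ by rw [h i, zero_comp]
    exact hf (by simpa using congrArg (· ≫ e.inv) h0)
  obtain ⟨i, hi⟩ := this
  have := hS i
  have := isIso_of_hom_simple hi
  refine ⟨e.hom ≫ biproduct.π S i ≫ inv ((f ≫ e.hom) ≫ biproduct.π S i), ?_⟩
  rw [← IsIso.hom_inv_id ((f ≫ e.hom) ≫ biproduct.π S i)]
  simp only [Category.assoc]

theorem simple_of_scalarEnd (hC : IsSemisimpleTensorCategory k C) (hV : ScalarEnd k V)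
    (h0 : 𝟙 V ≠ 0) : Simple V := by
  have : HasFiniteBiproducts C := Abelian.hasFiniteBiproducts
  obtain ⟨n, S, hS, ⟨e⟩⟩ := hC.semisimple V
  have : ∃ i, biproduct.π S i ≠ 0 := by
    by_contra! h
    refine h0 ?_
    have : e.hom = 0 := biproduct.hom_ext _ _ fun i ↦ by rw [h i, comp_zero, zero_comp]
    rw [← e.hom_inv_id, this, zero_comp]
  obtain ⟨i, -⟩ := this
  have := hS i
  have h1 : (biproduct.ι S i ≫ e.inv) ≫ (e.hom ≫ biproduct.π S i) = 𝟙 (S i) := by simp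
  have h2 := hV.comp_eq_id_of_retract h1 (id_nonzero _)
  exact Simple.of_iso ⟨e.hom ≫ biproduct.π S i, biproduct.ι S i ≫ e.inv, h2, h1⟩

/-- A retraction of the coevaluation is the desired evaluation. By duality it comes from a nonzero
map `g : V ⟶ Wᘁ`, which is a split monomorphism into an object with scalar endomorphisms, hence an
isomorphism. -/
theorem exists_exactPairing_symm (hC : IsSemisimpleTensorCategory k C) [Simple V]
    (hV : ScalarEnd k V) (P : ExactPairing V W) :
    ∃ Q : ExactPairing W V, P.coevaluation' ≫ Q.evaluation' = 𝟙 (𝟙_ C) := by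
  have := hC.simple_unit
  have hP : P.coevaluation' ≠ 0 := by
    intro h
    have h1 := P.evaluation_coevaluation'
    rw [h] at h1
    have h2 := congrArg (fun g ↦ (λ_ V).inv ≫ g ≫ (ρ_ V).hom) h1
    exact id_nonzero V (by simpa using h2.symm)
  obtain ⟨r, hr⟩ := hC.exists_retraction hP
  let Q : ExactPairing W Wᘁ := inferInstance
  obtain ⟨g, hg⟩ := exists_whiskerRight_comp_evaluation Q r
  have hg0 : g ≠ 0 := by
    rintro rfl
    rw [← hg] at hr
    exact id_nonzero (𝟙_ C) (by simpa using hr.symm)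
  obtain ⟨s, hs⟩ := hC.exists_retraction hg0
  have hs' : s ≫ g = 𝟙 _ :=
    ((hV.of_exactPairing P).of_exactPairing Q).comp_eq_id_of_retract hs (id_nonzero V)
  refine ⟨exactPairingCongrRight ⟨g, s, hs, hs'⟩, ?_⟩
  change P.coevaluation' ≫ g ▷ W ≫ Q.evaluation' = _
  rw [hg, hr]

theorem mugerEnd_ne_zero (hC : IsSemisimpleTensorCategory k C) [Simple V]
    (hV : ScalarEnd k V) (P : ExactPairing V W) (Q : ExactPairing W V) : mugerEnd P Q ≠ 0 := by
  have := hC.simple_unit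
  obtain ⟨Q₁, h₁⟩ := hC.exists_exactPairing_symm hV P
  have hW := hV.of_exactPairing P
  have hW0 : 𝟙 W ≠ 0 := by
    intro h
    have h2 : P.coevaluation' = 0 := by
      rw [← Category.comp_id P.coevaluation', ← MonoidalCategory.whiskerLeft_id, h]
      simp
    rw [h2, zero_comp] at h₁
    exact id_nonzero _ h₁.symm
  have := hC.simple_of_scalarEnd hW hW0
  obtain ⟨P₂, h₂⟩ := hC.exists_exactPairing_symm hW Q₁
  -- `Q₁` makes one factor `1`, and `P₂` pairs with `Q₁` to `1` on the other side. Since the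
  -- evaluations of `P` and `P₂` are proportional, the second factor for `P` and `Q₁` cannot vanish.
  obtain ⟨e, -, h3⟩ := exists_iso_of_exactPairing P P₂
  obtain ⟨s, hs⟩ := hW e.inv
  have h4 : P₂.evaluation' = s • P.evaluation' := by
    have : e.inv ▷ V ≫ P.evaluation' = P₂.evaluation' := by rw [← h3]; simp
    rw [← this, hs]
    simp
  rw [mugerEnd_unique hV P Q P Q₁]
  intro h
  rw [mugerEnd, h₁, Category.id_comp] at h
  rw [h4, Linear.comp_smul, h, smul_zero] at h₂
  exact id_nonzero _ h₂.symm

theorem scalarEnd_of_simple [IsAlgClosed k] (hC : IsSemisimpleTensorCategory k C) [Simple V] :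
    ScalarEnd k V := by
  intro f
  have := hC.finite_hom V V
  obtain ⟨c, hc⟩ := endomorphism_simple_eq_smul_id k f
  exact ⟨c, hc.symm⟩

theorem smul_id_unit_injective (hC : IsSemisimpleTensorCategory k C) :
    Function.Injective fun r : k ↦ r • 𝟙 (𝟙_ C) := by
  have := hC.simple_unit
  exact smul_left_injective k (id_nonzero (𝟙_ C))

theorem existsUnique_isMugerSquaredNorm [IsAlgClosed k] (hC : IsSemisimpleTensorCategory k C)
    [Simple V] : ∃! c : k, IsMugerSquaredNorm k V c := by
  have := hC.simple_unit
  have hV : ScalarEnd k V := hC.scalarEnd_of_simple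
  let P : ExactPairing V Vᘁ := inferInstance
  obtain ⟨Q, -⟩ := hC.exists_exactPairing_symm hV P
  obtain ⟨c, hc⟩ := hC.scalarEnd_of_simple (V := 𝟙_ C) (mugerEnd P Q)
  refine ⟨c, ⟨_, P, Q, hc⟩, ?_⟩
  rintro d ⟨W, P', Q', hd⟩
  refine hC.smul_id_unit_injective ?_
  change d • 𝟙 _ = c • 𝟙 _
  rw [← hc, ← hd]
  exact mugerEnd_unique hV P' Q' P Q

end IsSemisimpleTensorCategory

/-! ### Extension of scalars -/

namespace ScalarExtension

variable {R S : Type} [CommRing R] [CommRing S] {φ : R →+* S}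
    {C : Type u} [Category.{v} C] [Preadditive C] [Linear R C] [MonoidalCategory C]
    {D : Type u} [Category.{v} D] [Preadditive D] [Linear S D] [MonoidalCategory D]
    (E : ScalarExtension φ C D)

theorem hom_induction {X Y : C} {motive : (E.functor.obj X ⟶ E.functor.obj Y) → Prop}
    (zero : motive 0) (map : ∀ f : X ⟶ Y, motive (E.functor.map f))
    (smul : ∀ (s : S) f, motive f → motive (s • f))
    (add : ∀ f g, motive f → motive g → motive (f + g)) (h : E.functor.obj X ⟶ E.functor.obj Y) :
    motive h :=
  letI : Algebra R S := φ.toAlgebra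
  letI : Module R (E.functor.obj X ⟶ E.functor.obj Y) := Module.compHom _ φ
  haveI : IsScalarTower R S (E.functor.obj X ⟶ E.functor.obj Y) :=
    ⟨fun r s f ↦ mul_smul (φ r) s f⟩
  (E.isBaseChange X Y).inductionOn h motive zero map smul add

theorem scalarEnd_obj {X : C} (h : ScalarEnd R X) : ScalarEnd S (E.functor.obj X) := by
  intro f
  refine E.hom_induction (motive := fun f ↦ ∃ s : S, f = s • 𝟙 _) ⟨0, by simp⟩ ?_ ?_ ?_ f
  · intro f
    obtain ⟨r, rfl⟩ := h f
    exact ⟨φ r, by rw [E.map_smul, CategoryTheory.Functor.map_id]⟩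
  · rintro s _ ⟨t, rfl⟩
    exact ⟨s * t, by rw [mul_smul]⟩
  · rintro _ _ ⟨s, rfl⟩ ⟨t, rfl⟩
    exact ⟨s + t, by rw [add_smul]⟩

theorem map_surjective (hφ : Function.Surjective φ) {X Y : C} :
    Function.Surjective (E.functor.map : (X ⟶ Y) → _) := by
  have := E.additive
  intro f
  refine E.hom_induction (motive := fun f ↦ ∃ g, E.functor.map g = f) ⟨0, by simp⟩ ?_ ?_ ?_ f
  · exact fun f ↦ ⟨f, rfl⟩
  · rintro s _ ⟨t, rfl⟩
    obtain ⟨r, rfl⟩ := hφ s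
    exact ⟨r • t, E.map_smul r t⟩
  · rintro _ _ ⟨s, rfl⟩ ⟨t, rfl⟩
    exact ⟨s + t, E.functor.map_add⟩

/-- The inverse of `R ≃ End X` extends by base change to an `S`-linear map from the endomorphisms of
the image to `S`; it sends the identity to `1`, so it recovers `s` from `s • 𝟙`. -/
theorem smul_id_injective {X : C} (h : Function.Bijective fun r : R ↦ r • 𝟙 X) :
    Function.Injective fun s : S ↦ s • 𝟙 (E.functor.obj X) := by
  let : Algebra R S := φ.toAlgebra
  let : Module R (E.functor.obj X ⟶ E.functor.obj X) := Module.compHom _ φ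
  have : IsScalarTower R S (E.functor.obj X ⟶ E.functor.obj X) :=
    ⟨fun r s f ↦ mul_smul (φ r) s f⟩
  let e : R ≃ₗ[R] (X ⟶ X) := LinearEquiv.ofBijective (LinearMap.toSpanSingleton R _ (𝟙 X)) h
  let l := (E.isBaseChange X X).lift ((Algebra.linearMap R S).comp e.symm.toLinearMap)
  have hl : l (𝟙 _) = 1 := by
    have h1 := (E.isBaseChange X X).lift_eq ((Algebra.linearMap R S).comp e.symm.toLinearMap) (𝟙 X)
    have h2 : e 1 = 𝟙 X := one_smul R _
    have h3 : e.symm (𝟙 X) = 1 := by rw [← h2, e.symm_apply_apply]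
    have h4 : l (E.functor.map (𝟙 X)) = 1 := h1.trans (by simp [h3])
    rwa [CategoryTheory.Functor.map_id] at h4
  intro s t hst
  have := congrArg l hst
  simpa [hl] using this

variable {V W : C}

theorem map_mugerEnd [MonoidalPreadditive D] [MonoidalLinear S D] {P : ExactPairing V W}
    {Q : ExactPairing W V} {r : R} (h : mugerEnd P Q = r • 𝟙 _) :
    ∃ (P' : ExactPairing (E.functor.obj V) (E.functor.obj W))
      (Q' : ExactPairing (E.functor.obj W) (E.functor.obj V)), mugerEnd P' Q' = φ r • 𝟙 _ := by
  have := E.monoidal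
  refine ⟨mapExactPairing E.functor P, mapExactPairing E.functor Q, ?_⟩
  rw [mugerEnd_mapExactPairing, h, E.map_smul]
  simp

end ScalarExtension

theorem IsSemisimpleTensorCategoryOver.bijective_smul_id_unit {R : Type} [CommRing R]
    {C : Type u} [Category.{v} C]
    [Preadditive C] [HasFiniteBiproducts C] [Linear R C] [MonoidalCategory C]
    [MonoidalPreadditive C] [MonoidalLinear R C] [RigidCategory C]
    (hC : IsSemisimpleTensorCategoryOver R C) : Function.Bijective fun r : R ↦ r • 𝟙 (𝟙_ C) := by
  obtain ⟨I, S, hS, -, ⟨i, ⟨e⟩⟩, -⟩ := hC.exists_simples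
  refine ⟨fun a b h ↦ (hS i).1 (smul_id_faithful_of_iso e h), fun f ↦ ?_⟩
  have : ScalarEnd R (S i) := fun f ↦ (hS i).2 f |>.imp fun _ h ↦ h.symm
  obtain ⟨r, hr⟩ := this.of_iso e.symm f
  exact ⟨r, hr.symm⟩

/-! ### Reduction modulo the maximal ideal -/

section Local

variable {R : Type} [CommRing R] [IsLocalRing R] {C : Type u} [Category.{v} C]
    [Preadditive C] [Linear R C] [MonoidalCategory C]
    {D : Type u} [Category.{v} D] [Preadditive D] [Linear (IsLocalRing.ResidueField R) D]
    [MonoidalCategory D]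

open IsLocalRing

theorem ScalarExtension.isUnit_of_map_eq_id (E : ScalarExtension (residue R) C D) {X : C}
    (h0 : 𝟙 (E.functor.obj X) ≠ 0) {r : R} (h : E.functor.map (r • 𝟙 X) = 𝟙 _) : IsUnit r := by
  by_contra hr
  rw [E.map_smul, (residue_eq_zero_iff r).mpr hr, zero_smul] at h
  exact h0 h.symm

/-- An isomorphism modulo the maximal ideal between objects with scalar endomorphisms lifts. -/
theorem ScalarExtension.nonempty_iso_of_iso_obj (E : ScalarExtension (residue R) C D) {X Y : C}
    (hX : ScalarEnd R X) (hY : ScalarEnd R Y) (h0 : 𝟙 (E.functor.obj X) ≠ 0)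
    (i : E.functor.obj X ≅ E.functor.obj Y) : Nonempty (X ≅ Y) := by
  obtain ⟨f, hf⟩ := E.map_surjective residue_surjective i.hom
  obtain ⟨g, hg⟩ := E.map_surjective residue_surjective i.inv
  obtain ⟨r, hr⟩ := hX (f ≫ g)
  obtain ⟨s, hs⟩ := hY (g ≫ f)
  have h0' : 𝟙 (E.functor.obj Y) ≠ 0 := fun h ↦ h0 (by
    rw [← i.hom_inv_id, ← Category.comp_id i.hom, h, comp_zero, zero_comp])
  -- The composites of the lifts are scalars that act as the identity modulo the maximal ideal,
  -- hence units.
  have hr' : IsUnit r := E.isUnit_of_map_eq_id h0 (by rw [← hr]; simp [hf, hg])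
  have hs' : IsUnit s := E.isUnit_of_map_eq_id h0' (by rw [← hs]; simp [hf, hg])
  obtain ⟨r', hr'⟩ := hr'.exists_left_inv
  obtain ⟨s', hs'⟩ := hs'.exists_left_inv
  have h1 : f ≫ (r' • g) = 𝟙 X := by rw [Linear.comp_smul, hr, smul_smul, hr', one_smul]
  have h2 : (s' • g) ≫ f = 𝟙 Y := by rw [Linear.smul_comp, hs, smul_smul, hs', one_smul]
  have h3 : s' • g = r' • g := by
    rw [← Category.comp_id (s' • g), ← h1, reassoc_of% h2]
  exact ⟨⟨f, r' • g, h1, by rw [← h3, h2]⟩⟩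

end Local

section Unit

open IsLocalRing

variable {R : Type} [CommRing R] [IsLocalRing R] {L : Type u} [Category.{v} L]
    [Preadditive L] [HasFiniteBiproducts L] [Linear R L] [MonoidalCategory L]
    [MonoidalPreadditive L] [MonoidalLinear R L] [RigidCategory L]
    {D : Type u} [Category.{v} D] [Abelian D] [Linear (IsLocalRing.ResidueField R) D]
    [MonoidalCategory D] [MonoidalPreadditive D] [MonoidalLinear (IsLocalRing.ResidueField R) D]
    [RigidCategory D]

theorem exists_isUnit_mugerEnd (hC : IsSemisimpleTensorCategoryOver R L)
    (hD : IsSemisimpleTensorCategory (ResidueField R) D) (E : ScalarExtension (residue R) L D)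
    {X : L} (hX : Function.Bijective fun r : R ↦ r • 𝟙 X) :
    ∃ (W : L) (P : ExactPairing X W) (Q : ExactPairing W X) (r : R), IsUnit r ∧
      mugerEnd P Q = r • 𝟙 _ := by
  have := E.monoidal
  have hX' : ScalarEnd R X := fun f ↦ (hX.2 f).imp fun _ h ↦ h.symm
  have hF := E.scalarEnd_obj hX'
  have h0 : 𝟙 (E.functor.obj X) ≠ 0 := fun h ↦
    one_ne_zero (α := ResidueField R) (E.smul_id_injective hX (by simp [h]))
  have := hD.simple_of_scalarEnd hF h0
  let P : ExactPairing X Xᘁ := inferInstance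
  let Q₀ : ExactPairing Xᘁ Xᘁᘁ := inferInstance
  obtain ⟨Q', -⟩ := hD.exists_exactPairing_symm hF (mapExactPairing E.functor P)
  -- In the reduction, `X` and its double dual are both right duals of the image of `Xᘁ`, hence
  -- isomorphic there.
  obtain ⟨i, -⟩ := exists_iso_of_exactPairing Q' (mapExactPairing E.functor Q₀)
  obtain ⟨j⟩ := E.nonempty_iso_of_iso_obj hX' ((hX'.of_exactPairing P).of_exactPairing Q₀) h0 i
  let Q : ExactPairing Xᘁ X := exactPairingCongrRight j
  obtain ⟨r, hr⟩ := hC.bijective_smul_id_unit.2 (mugerEnd P Q)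
  refine ⟨_, P, Q, r, ?_, hr.symm⟩
  by_contra hu
  obtain ⟨P₁, Q₁, h₁⟩ := E.map_mugerEnd hr.symm
  rw [(residue_eq_zero_iff r).mpr hu, zero_smul] at h₁
  exact hD.mugerEnd_ne_zero hF P₁ Q₁ h₁

/-- Let `G` be the common scalar extension to a field of a category `C` over a field and of a
category `L` over a local ring that has a semisimple reduction. Then the squared norms of the
objects of `C` with scalar endomorphisms come from units of the local ring. -/
theorem IsMugerSquaredNorm.exists_isUnit {k K : Type} [Field k] [Field K] {φ : R →+* K}
    {ι : k →+* K} {C : Type u} [Category.{v} C] [Preadditive C] [Linear k C] [MonoidalCategory C]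
    {G : Type u} [Category.{v} G] [Preadditive G] [Linear K G] [MonoidalCategory G]
    [MonoidalPreadditive G] [MonoidalLinear K G] (hL : IsSemisimpleTensorCategoryOver R L)
    (hD : IsSemisimpleTensorCategory (ResidueField R) D) (E : ScalarExtension (residue R) L D)
    (F : ScalarExtension φ L G) (H : ScalarExtension ι C G)
    (h1 : Function.Bijective fun r : k ↦ r • 𝟙 (𝟙_ C))
    {V : C} (hV : Function.Bijective fun r : k ↦ r • 𝟙 V) {c : k}
    (hc : IsMugerSquaredNorm k V c) : ∃ r : R, IsUnit r ∧ φ r = ι c := by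
  obtain ⟨W, P, Q, hPQ⟩ := hc
  obtain ⟨P', Q', h'⟩ := H.map_mugerEnd hPQ
  have hHV : ScalarEnd K (H.functor.obj V) :=
    H.scalarEnd_obj fun f ↦ (hV.2 f).imp fun _ h ↦ h.symm
  have hHV0 : 𝟙 (H.functor.obj V) ≠ 0 := fun h ↦
    one_ne_zero (α := K) (H.smul_id_injective hV (by simp [h]))
  have := F.essSurj
  have := F.additive
  let X := F.functor.objPreimage (H.functor.obj V)
  let i : F.functor.obj X ≅ H.functor.obj V := F.functor.objObjPreimageIso _
  -- The image of `X` has scalar endomorphisms over the field `K`, so any one summand `S (s a)`,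
  -- whose image is a nonzero retract, already gives the whole image.
  obtain ⟨I, S, hS, -, -, hdec⟩ := hL.exists_simples
  obtain ⟨n, s, ⟨e⟩⟩ := hdec X
  -- An empty decomposition would make the image of `V` zero.
  have hn : ∃ a : Fin n, True := by
    by_contra! hn
    have h0 : 𝟙 X = 0 := by
      have : e.hom = 0 := biproduct.hom_ext _ _ fun a ↦ (hn a).elim
      rw [← e.hom_inv_id, this, zero_comp]
    have h0' : 𝟙 (F.functor.obj X) = 0 := by
      rw [← CategoryTheory.Functor.map_id, h0, Functor.map_zero]
    exact hHV0 (by rw [← i.inv_hom_id, ← Category.id_comp i.hom, h0', zero_comp, comp_zero])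
  obtain ⟨a, -⟩ := hn
  have hSa : 𝟙 (F.functor.obj (S (s a))) ≠ 0 := fun h ↦
    one_ne_zero (α := K) (F.smul_id_injective (hS (s a)) (by simp [h]))
  let u : S (s a) ⟶ X := biproduct.ι (fun a ↦ S (s a)) a ≫ e.inv
  let w : X ⟶ S (s a) := e.hom ≫ biproduct.π (fun a ↦ S (s a)) a
  have huw : F.functor.map u ≫ F.functor.map w = 𝟙 _ := by
    rw [← Functor.map_comp, ← CategoryTheory.Functor.map_id]
    congr 1
    simp [u, w]
  have hwu := (hHV.of_iso i.symm).comp_eq_id_of_retract huw hSa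
  let j : H.functor.obj V ≅ F.functor.obj (S (s a)) := i.symm ≪≫ ⟨_, _, hwu, huw⟩
  obtain ⟨W₁, P₁, Q₁, r, hr, h₁⟩ := exists_isUnit_mugerEnd hL hD E (hS (s a))
  refine ⟨r, hr, ?_⟩
  obtain ⟨P₂, Q₂, h₂⟩ := F.map_mugerEnd h₁
  obtain ⟨P₃, Q₃, h₃⟩ := exists_mugerEnd_of_iso j P₂ Q₂
  have h₄ : φ r • 𝟙 (𝟙_ G) = ι c • 𝟙 (𝟙_ G) := by
    rw [← h', ← h₂, ← h₃]
    exact mugerEnd_unique hHV _ _ _ _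
  have := H.monoidal
  exact H.smul_id_injective h1
    (smul_id_faithful_of_iso (Functor.Monoidal.εIso H.functor) h₄)

end Unit

theorem norm_eq_one_of_isUnit {p : ℕ} [Fact p.Prime] {r : ZpBar p} (hr : IsUnit r) :
    ‖algebraMap (ZpBar p) (PadicAlgCl p) r‖ = 1 := by
  obtain ⟨s, hs⟩ := hr.exists_right_inv
  have h (x : ZpBar p) : ‖algebraMap (ZpBar p) (PadicAlgCl p) x‖ ≤ 1 := x.2
  have h1 : ‖algebraMap (ZpBar p) (PadicAlgCl p) r‖ * ‖algebraMap (ZpBar p) (PadicAlgCl p) s‖ = 1 := by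
    rw [← norm_mul, ← map_mul, hs, map_one, norm_one]
  nlinarith [h r, h s, norm_nonneg (algebraMap (ZpBar p) (PadicAlgCl p) r)]

theorem norm_eq_one_of_isGoodPrimeAt {p : ℕ} [Fact p.Prime] {C : Type u} [Category.{v} C]
    [Abelian C]
    [Linear (AlgebraicClosure ℚ) C] [MonoidalCategory C] [MonoidalPreadditive C]
    [MonoidalLinear (AlgebraicClosure ℚ) C] [RigidCategory C]
    (hC : IsSemisimpleTensorCategory (AlgebraicClosure ℚ) C)
    {ι : AlgebraicClosure ℚ →+* PadicAlgCl p} (h : IsGoodPrimeAt p C ι) {V : C} [Simple V]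
    {c : AlgebraicClosure ℚ} (hc : IsMugerSquaredNorm (AlgebraicClosure ℚ) V c) : ‖ι c‖ = 1 := by
  have bij (X : C) [Simple X] : Function.Bijective fun r : AlgebraicClosure ℚ ↦ r • 𝟙 X :=
    ⟨smul_left_injective _ (id_nonzero X),
      fun f ↦ (hC.scalarEnd_of_simple f).imp fun _ h ↦ h.symm⟩
  have := hC.simple_unit
  obtain ⟨G⟩ := h
  cases G with
  | mk Red hRed _ Lift hLift E Gen F H =>
  obtain ⟨r, hr, h⟩ := hc.exists_isUnit hLift hRed E F H (bij _) (bij V)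
  rw [← h]
  exact norm_eq_one_of_isUnit hr

/-! ### Algebraic numbers -/

theorem algebraicNorm_eq_coeff_zero_minpoly {K : Type} [Field K] [Algebra ℚ K] {α : K}
    (h : IsIntegral ℚ α) :
    algebraicNorm α = (-1) ^ (minpoly ℚ α).natDegree * (minpoly ℚ α).coeff 0 := by
  have := @Algebra.PowerBasis.norm_gen_eq_coeff_zero_minpoly _ _ _ _
    (IntermediateField.algebra' _)
    (IntermediateField.adjoin.powerBasis h)
  rw [IntermediateField.adjoin.powerBasis_gen, IntermediateField.minpoly_gen,
    IntermediateField.adjoin.powerBasis_dim] at this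
  rw [← this, algebraicNorm]
  congr!
  exact Subsingleton.elim _ _

/-- The norm depends only on the minimal polynomial, which field embeddings preserve. -/
theorem isRelativelyPrime_map_iff {K L : Type} [Field K] [Algebra ℚ K] [Field L] [Algebra ℚ L]
    (p : ℕ) (f : K →+* L) (α : K) : IsRelativelyPrime p (f α) ↔ IsRelativelyPrime p α := by
  let g : K →ₐ[ℚ] L := f.toRatAlgHom
  have h0 : IsAlgebraic ℚ (f α) ↔ IsAlgebraic ℚ α := isAlgebraic_algHom_iff g g.injective
  have h1 : minpoly ℚ (f α) = minpoly ℚ α := minpoly.algHom_eq g g.injective α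
  unfold IsRelativelyPrime
  rw [h0]
  refine and_congr_right fun h ↦ ?_
  rw [algebraicNorm_eq_coeff_zero_minpoly h.isIntegral,
    algebraicNorm_eq_coeff_zero_minpoly (h0.mpr h).isIntegral, h1]

/-- Numerator and denominator have the same absolute value, so `p` divides both or neither; lowest
terms exclude both. -/
theorem isCoprime_num_of_padicNorm_eq_one {p : ℕ} [hp : Fact p.Prime] {q : ℚ}
    (h : ‖(q : ℚ_[p])‖ = 1) : IsCoprime q.num (p : ℤ) ∧ Nat.Coprime q.den p := by
  have hden0 : ‖(q.den : ℚ_[p])‖ ≠ 0 := by simp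
  have hq : ‖(q.num : ℚ_[p])‖ = ‖((q.den : ℤ) : ℚ_[p])‖ := by
    rw [Rat.cast_def, norm_div, div_eq_one_iff_eq hden0] at h
    simpa using h
  have hiff : (p : ℤ) ∣ q.num ↔ (p : ℤ) ∣ (q.den : ℤ) := by
    rw [← Padic.norm_intCast_lt_one_iff, ← Padic.norm_intCast_lt_one_iff, hq]
  have hred : ¬ (p ∣ q.num.natAbs ∧ p ∣ q.den) := fun ⟨h1, h2⟩ ↦
    hp.1.ne_one (Nat.eq_one_of_dvd_coprimes q.reduced h1 h2)
  rw [Int.natCast_dvd, Int.natCast_dvd_natCast] at hiff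
  rw [Int.isCoprime_iff_gcd_eq_one, Int.gcd, Int.natAbs_natCast, ← Nat.coprime_iff_gcd_eq_one,
    Nat.coprime_comm, hp.1.coprime_iff_not_dvd, Nat.coprime_comm, hp.1.coprime_iff_not_dvd]
  tauto

theorem norm_algebraNorm_eq_one {p : ℕ} [Fact p.Prime] {L : Type} [Field L] [CharZero L]
    [FiniteDimensional ℚ L] {x : L} (h : ∀ σ : L →+* PadicAlgCl p, ‖σ x‖ = 1) :
    ‖((Algebra.norm ℚ x : ℚ) : ℚ_[p])‖ = 1 := by
  rw [← PadicAlgCl.norm_extends, map_ratCast, ← eq_ratCast (algebraMap ℚ (PadicAlgCl p)),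
    Algebra.norm_eq_prod_embeddings, norm_prod]
  exact Finset.prod_eq_one fun σ _ ↦ h σ.toRingHom

theorem isRelativelyPrime_of_norm_eq_one {p : ℕ} [Fact p.Prime] {c : AlgebraicClosure ℚ}
    (h : ∀ ι : AlgebraicClosure ℚ →+* PadicAlgCl p, ‖ι c‖ = 1) : IsRelativelyPrime p c := by
  have : Algebra.IsAlgebraic ℚ (AlgebraicClosure ℚ) := by
    convert! AlgebraicClosure.isAlgebraic ℚ
  have hc : IsAlgebraic ℚ c := Algebra.IsAlgebraic.isAlgebraic c
  have : FiniteDimensional ℚ (IntermediateField.adjoin ℚ {c}) := by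
    convert! IntermediateField.adjoin.finiteDimensional hc.isIntegral
  have : Algebra.IsAlgebraic (IntermediateField.adjoin ℚ {c}) (AlgebraicClosure ℚ) :=
    Algebra.IsAlgebraic.tower_top (K := ℚ) _
  refine ⟨hc, isCoprime_num_of_padicNorm_eq_one (norm_algebraNorm_eq_one fun σ ↦ ?_)⟩
  let := σ.toAlgebra
  -- The hypothesis concerns embeddings of the whole algebraic closure, so the embedding `σ` of
  -- `ℚ(c)` is extended to it.
  let τ : AlgebraicClosure ℚ →ₐ[IntermediateField.adjoin ℚ {c}] PadicAlgCl p := IsAlgClosed.lift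
  have hτ := τ.commutes (IntermediateField.AdjoinSimple.gen ℚ c)
  rw [IntermediateField.AdjoinSimple.algebraMap_gen, RingHom.algebraMap_toAlgebra] at hτ
  rw [← hτ]
  exact h τ.toRingHom

/-! ### Frobenius–Perron dimensions -/

theorem aeval_charpoly_eq_zero_of_mulVec_eq_smul {n : Type*} [Fintype n] [DecidableEq n]
    {A : Matrix n n ℤ} {t : ℝ} {x : n → ℝ} (hx : x ≠ 0)
    (h : (A.map (Int.castRingHom ℝ)).mulVec x = t • x) : A.charpoly.aeval t = 0 := by
  have h1 : (A.map (Int.castRingHom ℝ)).charpoly.eval t = 0 := by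
    rw [Matrix.eval_charpoly, ← Matrix.exists_mulVec_eq_zero_iff]
    refine ⟨x, hx, ?_⟩
    rw [Matrix.sub_mulVec, h]
    simp
  rwa [Matrix.charpoly_map, Polynomial.eval_map] at h1

/-- Real eigenvalues are roots of the monic integral characteristic polynomial. They form a finite
set, so the supremum is one of them if there are any; otherwise it is `0` by convention. -/
theorem isIntegral_fpDim {k : Type} [Field k] {C : Type u} [Category.{v} C] [Preadditive C]
    [Linear k C] [MonoidalCategory C] [Finite (SimpleClass C)] (V : C) :
    IsIntegral ℤ (fpDim k V) := by
  classical
  let : Fintype (SimpleClass C) := Fintype.ofFinite _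
  let A : Matrix (SimpleClass C) (SimpleClass C) ℤ := .of fun c b ↦ (multiplicity k V c b : ℤ)
  let s : Set ℝ := {t : ℝ | ∃ x : SimpleClass C → ℝ, x ≠ 0 ∧
    (Matrix.of fun c b ↦ (multiplicity k V c b : ℝ)).mulVec x = t • x}
  have hA : A.map (Int.castRingHom ℝ) = .of fun c b ↦ (multiplicity k V c b : ℝ) := by
    ext
    simp [A]
  have hs : ∀ t ∈ s, A.charpoly.aeval t = 0 := fun t ⟨x, hx, h⟩ ↦
    aeval_charpoly_eq_zero_of_mulVec_eq_smul hx (hA ▸ h)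
  have hint : ∀ t ∈ s, IsIntegral ℤ t := fun t ht ↦ ⟨A.charpoly, A.charpoly_monic, hs t ht⟩
  have hfin : s.Finite := (A.charpoly.rootSet_finite ℝ).subset fun t ht ↦
    (Polynomial.mem_rootSet_of_ne A.charpoly_monic.ne_zero).mpr (hs t ht)
  change IsIntegral ℤ (sSup s)
  rcases s.eq_empty_or_nonempty with h | h
  · rw [h, Real.sSup_empty]
    exact isIntegral_zero
  · exact hint _ (h.csSup_mem hfin)

/-- A square root of the squared norm that is mapped to the Frobenius–Perron dimension. -/
theorem IsPseudounitary.exists_sq_eq {k : Type} [Field k] [IsAlgClosed k] {C : Type u}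
    [Category.{v} C] [Preadditive C] [Linear k C] [MonoidalCategory C] [Finite (SimpleClass C)]
    {τ : k →+* ℂ} (h : IsPseudounitary (C := C) k τ) {V : C} (hV : Simple V) {c : k}
    (hc : IsMugerSquaredNorm k V c) : ∃ d : k, d ^ 2 = c ∧ τ d = (fpDim k V : ℂ) := by
  obtain ⟨d, hd⟩ := IsAlgClosed.exists_pow_nat_eq c two_pos
  have h1 : τ d ^ 2 = (fpDim k V : ℂ) ^ 2 := by rw [← map_pow, hd, h V hV c hc]
  -- The sign of the square root is chosen so that `τ` sends it to the Frobenius–Perron dimension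
  -- itself.
  rcases sq_eq_sq_iff_eq_or_eq_neg.mp h1 with h2 | h2
  · exact ⟨d, hd, h2⟩
  · exact ⟨-d, by rw [neg_sq, hd], by rw [map_neg, h2, neg_neg]⟩

end TensorReduction

end

/-! ### The proposition and its corollary -/

theorem mainTheorem5 (p : ℕ) [Fact p.Prime] (C : Type u) [Category.{v} C] [Abelian C]
    [Linear (AlgebraicClosure ℚ) C] [MonoidalCategory C] [MonoidalPreadditive C]
    [MonoidalLinear (AlgebraicClosure ℚ) C] [RigidCategory C]
    (hC : TensorReduction.IsSemisimpleTensorCategory (AlgebraicClosure ℚ) C) :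
    -- Müger's squared norm of a simple object exists and is unique
    (∀ V : C, Simple V →
      ∃! c : AlgebraicClosure ℚ, TensorReduction.IsMugerSquaredNorm (AlgebraicClosure ℚ) V c) ∧
    -- good reduction at one place above `p`: squared norms are units at that place
    (∀ ι : AlgebraicClosure ℚ →+* PadicAlgCl p, TensorReduction.IsGoodPrimeAt p C ι →
      ∀ V : C, Simple V → ∀ c : AlgebraicClosure ℚ,
        TensorReduction.IsMugerSquaredNorm (AlgebraicClosure ℚ) V c → ‖ι c‖ = 1) ∧
    -- good primes are relatively prime to squared norms
    (TensorReduction.IsGoodPrime p C →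
      ∀ V : C, Simple V → ∀ c : AlgebraicClosure ℚ,
        TensorReduction.IsMugerSquaredNorm (AlgebraicClosure ℚ) V c →
          TensorReduction.IsRelativelyPrime p c) ∧
    -- the case of a pseudounitary fusion category
    (∀ (_ : Finite (TensorReduction.SimpleClass C)) (τ : AlgebraicClosure ℚ →+* ℂ),
      TensorReduction.IsPseudounitary (C := C) (AlgebraicClosure ℚ) τ →
      (∀ ι : AlgebraicClosure ℚ →+* PadicAlgCl p, TensorReduction.IsGoodPrimeAt p C ι →
        ∀ V : C, Simple V → ∃ d : AlgebraicClosure ℚ,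
          τ d = (TensorReduction.fpDim (AlgebraicClosure ℚ) V : ℂ) ∧ ‖ι d‖ = 1) ∧
      (TensorReduction.IsGoodPrime p C → ∀ V : C, Simple V →
        IsIntegral ℤ (TensorReduction.fpDim (AlgebraicClosure ℚ) V) ∧
        TensorReduction.IsRelativelyPrime p
          (TensorReduction.fpDim (AlgebraicClosure ℚ) V))) := by
  have hexists := fun (V : C) (hV : Simple V) ↦
    hC.existsUnique_isMugerSquaredNorm (V := V)
  have hnorm : ∀ ι : AlgebraicClosure ℚ →+* PadicAlgCl p, TensorReduction.IsGoodPrimeAt p C ι →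
      ∀ V : C, Simple V → ∀ c : AlgebraicClosure ℚ,
        TensorReduction.IsMugerSquaredNorm (AlgebraicClosure ℚ) V c → ‖ι c‖ = 1 :=
    fun ι h V _ c hc ↦ TensorReduction.norm_eq_one_of_isGoodPrimeAt hC h hc
  refine ⟨hexists, hnorm, fun h V hV c hc ↦
    TensorReduction.isRelativelyPrime_of_norm_eq_one fun ι ↦ hnorm ι (h ι) V hV c hc,
    fun _ τ hτ ↦ ?_⟩
  -- `d` is chosen independently of `ι`, so that for a good prime a single `d` serves all
  -- embeddings.
  have hsq : ∀ V : C, Simple V → ∃ d : AlgebraicClosure ℚ,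
      τ d = (TensorReduction.fpDim (AlgebraicClosure ℚ) V : ℂ) ∧
      ∀ ι : AlgebraicClosure ℚ →+* PadicAlgCl p, TensorReduction.IsGoodPrimeAt p C ι →
        ‖ι d‖ = 1 := by
    intro V hV
    obtain ⟨c, hc, -⟩ := hexists V hV
    obtain ⟨d, hd, hτd⟩ := hτ.exists_sq_eq hV hc
    refine ⟨d, hτd, fun ι hι ↦ ?_⟩
    have h := hnorm ι hι V hV c hc
    rwa [← hd, map_pow, norm_pow, pow_eq_one_iff_of_nonneg (norm_nonneg _) two_ne_zero] at h
  refine ⟨fun ι hι V hV ↦ (hsq V hV).imp fun d hd ↦ ⟨hd.1, hd.2 ι hι⟩, fun hp V hV ↦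
    ⟨TensorReduction.isIntegral_fpDim V, ?_⟩⟩
  obtain ⟨d, hd, hd1⟩ := hsq V hV
  -- The claim passes from the real number `FPdim V` to its image in `ℂ`, which is `τ d`, and from
  -- there back to `d`.
  rw [← TensorReduction.isRelativelyPrime_map_iff p Complex.ofRealHom, Complex.ofRealHom_eq_coe,
    ← hd, TensorReduction.isRelativelyPrime_map_iff]
  exact TensorReduction.isRelativelyPrime_of_norm_eq_one fun ι ↦ hd1 ι (hp ι)
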